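/- Let $\mathfrak{S}_n$ be the symmetric group on $\{1,\dots,n\}$. For $\pi\in\mathfrak{S}_n$ let $\mathsf{exc}(\pi)=|\{i:\pi(i)>i\}|$ be its number of excedances, $\mathsf{inv}(\pi)=|\{(i,j): i<j,\ \pi(i)>\pi(j)\}|$ its number of inversions, and $\mathsf{cyc}(\pi)$ its number of cycles. Let $\mathfrak{SD}_n^{+}$ (respectively $\mathfrak{SD}_n^{-}$) be the set of derangements $\pi\in\mathfrak{S}_n$ (that is, $\pi(i)\neq i$ for all $i$) that are even (respectively odd) permutations. Then for every positive integer $n$ and for each choice $\mathsf{stat}\in\{\mathsf{cyc},\mathsf{inv}\}$ there are polynomials $b_{n,i}^{+}(q)$ and $b_{n,i}^{-}(q)$ in $q$, for $0\le i\le\lfloor n/2\rfloor$, all of whose coefficients are nonnegative integers, such that $$\sum_{\pi\in\mathfrak{SD}_n^{+}} q^{\mathsf{stat}(\pi)}t^{\mathsf{exc}(\pi)}=\sum_{i=0}^{\lfloor n/2\rfloor} b_{n,i}^{+}(q)\,t^{i}(1+t)^{n-2i} \quad\text{and}\quad \sum_{\pi\in\mathfrak{SD}_n^{-}} q^{\mathsf{stat}(\pi)}t^{\mathsf{exc}(\pi)}=\sum_{i=0}^{\lfloor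 n/2\rfloor} b_{n,i}^{-}(q)\,t^{i}(1+t)^{n-2i}.$$ -/

import Mathlib

open Polynomial

/-- The number of excedances of `π`: positions `i` with `π i > i`. -/
def permExc {n : ℕ} (π : Equiv.Perm (Fin n)) : ℕ :=
  (Finset.univ.filter fun i : Fin n => i < π i).card

/-- The number of inversions of `π`: pairs `i < j` with `π i > π j`. -/
def permInv {n : ℕ} (π : Equiv.Perm (Fin n)) : ℕ :=
  (Finset.univ.filter fun p : Fin n × Fin n => p.1 < p.2 ∧ π p.2 < π p.1).card

/-- The number of cycles of `π`, fixed points included (the number of parts of its cycle type,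
as a partition of `n`). -/
def permCyc {n : ℕ} (π : Equiv.Perm (Fin n)) : ℕ :=
  Multiset.card π.partition.parts

/-- The derangements of `Fin n` that are even permutations. -/
def evenDerangements (n : ℕ) : Finset (Equiv.Perm (Fin n)) :=
  Finset.univ.filter fun π => π ∈ derangements (Fin n) ∧ Equiv.Perm.sign π = 1

/-- The derangements of `Fin n` that are odd permutations. -/
def oddDerangements (n : ℕ) : Finset (Equiv.Perm (Fin n)) :=
  Finset.univ.filter fun π => π ∈ derangements (Fin n) ∧ Equiv.Perm.sign π = -1

/-- The polynomial `∑ π ∈ S, q ^ stat π * t ^ exc π`, as an element of `ℤ[q][t]`: the outer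
variable is `t`, the variable of the coefficient ring is `q`. -/
noncomputable def statExcPoly {n : ℕ} (stat : Equiv.Perm (Fin n) → ℕ)
    (S : Finset (Equiv.Perm (Fin n))) : ℤ[X][X] :=
  ∑ π ∈ S, C ((X : ℤ[X]) ^ stat π) * (X : ℤ[X][X]) ^ permExc π

/-!
The sign of a permutation `π` of `Fin n` is `(-1) ^ inv π = (-1) ^ (cyc π + n)`. Hence even
and odd derangements are told apart by the parity of the exponent of `q`, and since
passing to one parity of this exponent preserves gamma-expansions with nonnegative coefficients
(`exists_gamma_of_sign_eq`), it suffices to treat the sum over all derangements. That it lies in the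
cone `gammaCone n` is proved separately for the two statistics.

*Cycles.* A new smallest element of a permutation either is a fixed point, or its insertion does not
change the number of cycles. With the number of fixed points recorded, this yields a recurrence
(`cycExcPoly_succ`) built from multiplication by `q`, multiplication by `t`, and the Eulerian
operator `f ↦ m t f + t (1 - t) f'`, each of which respects the gamma cones. Derangements are
the case without fixed points.

*Inversions.* Passing to the inverse turns excedances into anti-excedances and preserves inversions.
Fix the set `V` of anti-excedance positions and the set `E` of anti-excedance values. The number of
inversions between an anti-excedance and an excedance depends only on `E` and `V`
(`permInv_add_coInv`), while those within each class are counted by a `q`-rook identity for Ferrers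
boards (`sum_qpow_permInv_of_lt`). So the inversion polynomial `antiexcInvPoly E V` is, up to a power
of `q`, a product of `q`-integers (`antiexcInvPoly_mul`), and this product shows that it does
not change if an element is added to both `E` and `V` (`antiexcInvPoly_insert`). It thus depends only
on `R = E \ V` and `P = V \ E`, and summing `t ^ #V` over `V = P ∪ S`, `E = R ∪ S` with
`S ⊆ (R ∪ P)ᶜ` gives `t ^ #P * (1 + t) ^ (n - 2 * #P)`.
-/

/-! ### The cone of gamma-positive polynomials -/

/-- The polynomials in `t` with nonnegative coefficients in the basis `t ^ i * (1 + t) ^ (m - 2 * i)`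
of the polynomials that are palindromic with centre of symmetry `m / 2`. Nonnegativity of an element
of `ℤ[q]` is coefficientwise. -/
noncomputable def gammaCone (m : ℕ) : AddSubmonoid ℤ[X][X] :=
  AddSubmonoid.closure {f | ∃ (b : ℤ[X]) (i j : ℕ), (∀ k, 0 ≤ b.coeff k) ∧ 2 * i + j = m ∧
    f = C b * X ^ i * (1 + X) ^ j}

theorem gamma_mem_gammaCone {b : ℤ[X]} (hb : ∀ k, 0 ≤ b.coeff k) {i j m : ℕ} (h : 2 * i + j = m) :
    C b * (X : ℤ[X][X]) ^ i * (1 + X) ^ j ∈ gammaCone m :=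
  AddSubmonoid.subset_closure ⟨b, i, j, hb, h, rfl⟩

theorem exists_of_mem_gammaCone {m : ℕ} {f : ℤ[X][X]} (hf : f ∈ gammaCone m) :
    ∃ b : ℕ → ℤ[X], (∀ i k : ℕ, 0 ≤ (b i).coeff k) ∧
      f = ∑ i ∈ Finset.range (m / 2 + 1), C (b i) * X ^ i * (1 + X) ^ (m - 2 * i) := by
  induction hf using AddSubmonoid.closure_induction with
  | mem f hf =>
    obtain ⟨b, i, j, hb, hm, rfl⟩ := hf
    refine ⟨Pi.single i b, fun i' k => ?_, ?_⟩
    · by_cases h : i' = i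
      · subst h; simpa using hb k
      · simp [h]
    · rw [Finset.sum_eq_single_of_mem i (by simp; omega)]
      · simp [show m - 2 * i = j by omega]
      · intro i' _ h
        simp [h]
  | zero => exact ⟨0, by simp, by simp⟩
  | add f g _ _ hf hg =>
    obtain ⟨b, hb, rfl⟩ := hf
    obtain ⟨c, hc, rfl⟩ := hg
    refine ⟨b + c, fun i k => by simpa using add_nonneg (hb i k) (hc i k), ?_⟩
    simp [add_mul, Finset.sum_add_distrib]

theorem X_mul_mem_gammaCone {m : ℕ} {f : ℤ[X][X]} (hf : f ∈ gammaCone m) :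
    X * f ∈ gammaCone (m + 2) := by
  induction hf using AddSubmonoid.closure_induction with
  | mem f hf =>
    obtain ⟨b, i, j, hb, hm, rfl⟩ := hf
    convert gamma_mem_gammaCone hb (show 2 * (i + 1) + j = m + 2 by omega) using 1
    ring
  | zero => simp
  | add f g _ _ hf hg => rw [mul_add]; exact add_mem hf hg

theorem C_X_mul_mem_gammaCone {m : ℕ} {f : ℤ[X][X]} (hf : f ∈ gammaCone m) :
    C X * f ∈ gammaCone m := by
  induction hf using AddSubmonoid.closure_induction with
  | mem f hf =>
    obtain ⟨b, i, j, hb, hm, rfl⟩ := hf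
    have hXb : ∀ k, 0 ≤ (X * b).coeff k := by
      rintro (_ | k)
      · simp
      · simpa using hb k
    convert gamma_mem_gammaCone hXb hm using 1
    rw [C_mul]; ring
  | zero => simp
  | add f g _ _ hf hg => rw [mul_add]; exact add_mem hf hg

/-- The Eulerian operator `f ↦ m t f + t (1 - t) f'` maps `t ^ i (1 + t) ^ (m - 2 i)` to
`i t ^ i (1 + t) ^ (m + 1 - 2 i) + 2 (m - 2 i) t ^ (i + 1) (1 + t) ^ (m - 1 - 2 i)`. -/
theorem eulerian_operator_mem_gammaCone {m : ℕ} {f : ℤ[X][X]} (hf : f ∈ gammaCone m) :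
    (m : ℤ[X][X]) * X * f + X * (1 - X) * derivative f ∈ gammaCone (m + 1) := by
  induction hf using AddSubmonoid.closure_induction with
  | mem f hf =>
    obtain ⟨b, i, j, hb, rfl, rfl⟩ := hf
    have h1 := nsmul_mem (gamma_mem_gammaCone hb (show 2 * i + (j + 1) = 2 * i + j + 1 by omega)) i
    have h2 : (2 * j) • (C b * X ^ (i + 1) * (1 + X) ^ (j - 1)) ∈ gammaCone (2 * i + j + 1) := by
      rcases j with _ | j
      · simp
      · exact nsmul_mem (gamma_mem_gammaCone hb (by omega)) _
    convert add_mem h1 h2 using 1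
    have hX : (X : ℤ[X][X]) * derivative (X ^ i) = (i : ℤ[X][X]) * X ^ i := by
      rcases i with _ | i
      · simp
      · simp; ring
    have hY : derivative ((1 + X : ℤ[X][X]) ^ j) = (j : ℤ[X][X]) * (1 + X) ^ (j - 1) := by
      simp [derivative_pow]
    have hj : (j : ℤ[X][X]) * (1 + X) ^ j = (j : ℤ[X][X]) * ((1 + X) ^ (j - 1) * (1 + X)) := by
      rcases j with _ | j
      · simp
      · simp [pow_succ]
    rw [derivative_mul, derivative_mul, derivative_C, zero_mul, zero_add, hY]
    simp only [nsmul_eq_mul]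
    push_cast
    linear_combination (C b * (1 - X) * (1 + X) ^ j) * hX + (C b * X ^ i * X) * hj
  | zero => simp
  | add f g _ _ hf hg =>
    convert add_mem hf hg using 1
    rw [derivative_add]; ring

/-! ### Splitting by the parity of the exponent of `q` -/

/-- The part of a polynomial consisting of the monomials whose exponent is congruent to `ε`
modulo `2`. -/
noncomputable def parityPart (ε : ℕ) (b : ℤ[X]) : ℤ[X] :=
  ∑ k ∈ b.support with k % 2 = ε, monomial k (b.coeff k)

theorem coeff_parityPart (ε : ℕ) (b : ℤ[X]) (k : ℕ) :
    (parityPart ε b).coeff k = if k % 2 = ε then b.coeff k else 0 := by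
  simp only [parityPart, finsetSum_coeff, coeff_monomial, Finset.sum_ite_eq', Finset.mem_filter,
    mem_support_iff]
  split_ifs <;> simp_all

theorem coeff_coeff_C_mul_map_C (b : ℤ[X]) (p : ℤ[X]) (j k : ℕ) :
    ((C b * p.map C).coeff j).coeff k = b.coeff k * p.coeff j := by
  rw [coeff_C_mul, coeff_map, coeff_mul_C]

theorem coeff_coeff_statExcPoly {n : ℕ} (stat : Equiv.Perm (Fin n) → ℕ)
    (S : Finset (Equiv.Perm (Fin n))) (j k : ℕ) :
    ((statExcPoly stat S).coeff j).coeff k =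
      ∑ π ∈ S, if k = stat π ∧ j = permExc π then 1 else 0 := by
  simp only [statExcPoly, finsetSum_coeff, coeff_C_mul, coeff_X_pow]
  refine Finset.sum_congr rfl fun π _ => ?_
  by_cases h : j = permExc π <;> simp [h, coeff_X_pow]

theorem statExcPoly_filter_parity {n m : ℕ} (stat : Equiv.Perm (Fin n) → ℕ)
    (S : Finset (Equiv.Perm (Fin n))) (b : ℕ → ℤ[X])
    (h : statExcPoly stat S = ∑ i ∈ Finset.range (m / 2 + 1),
      C (b i) * X ^ i * (1 + X) ^ (m - 2 * i)) (ε : ℕ) :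
    statExcPoly stat {π ∈ S | stat π % 2 = ε} = ∑ i ∈ Finset.range (m / 2 + 1),
      C (parityPart ε (b i)) * X ^ i * (1 + X) ^ (m - 2 * i) := by
  have hmap : ∀ i : ℕ, (X : ℤ[X][X]) ^ i * (1 + X) ^ (m - 2 * i) =
      (X ^ i * (1 + X) ^ (m - 2 * i) : ℤ[X]).map C := by simp
  ext j k
  have hjk := congrArg (fun f : ℤ[X][X] => (f.coeff j).coeff k) h
  simp only [mul_assoc, hmap, finsetSum_coeff, coeff_coeff_C_mul_map_C,
    coeff_coeff_statExcPoly] at hjk ⊢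
  simp only [coeff_parityPart, Finset.sum_filter]
  by_cases hk : k % 2 = ε
  · simp only [hk, if_true, ← hjk]
    refine Finset.sum_congr rfl fun π _ => ?_
    by_cases hs : k = stat π
    · simp [← hs, hk]
    · simp [hs]
  · simp only [hk, if_false, zero_mul, Finset.sum_const_zero]
    refine Finset.sum_eq_zero fun π _ => ?_
    by_cases hs : k = stat π
    · simp [← hs, hk]
    · simp [hs]

/-- If the sign of a permutation is determined by the parity of `stat`, gamma-positivity over all
derangements descends to the even and to the odd derangements. -/
theorem exists_gamma_of_sign_eq {n : ℕ} (stat : Equiv.Perm (Fin n) → ℕ) (c : ℕ)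
    (hsign : ∀ π : Equiv.Perm (Fin n), Equiv.Perm.sign π = (-1) ^ (stat π + c))
    (h : statExcPoly stat {π | π ∈ derangements (Fin n)} ∈ gammaCone n) :
    (∃ b : ℕ → ℤ[X], (∀ i k : ℕ, 0 ≤ (b i).coeff k) ∧
      statExcPoly stat (evenDerangements n) =
        ∑ i ∈ Finset.range (n / 2 + 1),
          C (b i) * (X : ℤ[X][X]) ^ i * (1 + (X : ℤ[X][X])) ^ (n - 2 * i)) ∧
    (∃ b : ℕ → ℤ[X], (∀ i k : ℕ, 0 ≤ (b i).coeff k) ∧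
      statExcPoly stat (oddDerangements n) =
        ∑ i ∈ Finset.range (n / 2 + 1),
          C (b i) * (X : ℤ[X][X]) ^ i * (1 + (X : ℤ[X][X])) ^ (n - 2 * i)) := by
  obtain ⟨b, hb, hsum⟩ := exists_of_mem_gammaCone h
  have hpos : ∀ ε i k : ℕ, 0 ≤ (parityPart ε (b i)).coeff k := by
    intro ε i k
    rw [coeff_parityPart]
    split_ifs
    exacts [hb i k, le_rfl]
  have heven : evenDerangements n =
      {π ∈ ({π | π ∈ derangements (Fin n)} : Finset (Equiv.Perm (Fin n))) |
        stat π % 2 = c % 2} := by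
    ext π
    rw [evenDerangements, Finset.mem_filter, Finset.mem_filter, Finset.mem_filter, hsign,
      neg_one_pow_eq_one_iff_even (by decide), Nat.even_iff, and_assoc]
    have : (stat π + c) % 2 = 0 ↔ stat π % 2 = c % 2 := by omega
    rw [this]
  have hodd : oddDerangements n =
      {π ∈ ({π | π ∈ derangements (Fin n)} : Finset (Equiv.Perm (Fin n))) |
        stat π % 2 = (c + 1) % 2} := by
    ext π
    rw [oddDerangements, Finset.mem_filter, Finset.mem_filter, Finset.mem_filter, hsign,
      neg_one_pow_eq_neg_one_iff_odd (by decide), Nat.odd_iff, and_assoc]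
    have : (stat π + c) % 2 = 1 ↔ stat π % 2 = (c + 1) % 2 := by omega
    rw [this]
  exact ⟨⟨_, hpos _, heven ▸ statExcPoly_filter_parity stat _ b hsum _⟩,
    ⟨_, hpos _, hodd ▸ statExcPoly_filter_parity stat _ b hsum _⟩⟩

/-! ### Cycles under the insertion of a new smallest element -/

theorem permCyc_eq {n : ℕ} (π : Equiv.Perm (Fin n)) :
    permCyc π = Multiset.card π.cycleType + Finset.card {i | π i = i} := by
  have h : ({i | π i = i} : Finset (Fin n)) = π.supportᶜ := by
    ext i; simp
  rw [permCyc, Equiv.Perm.parts_partition, Multiset.card_add, Multiset.card_replicate, h,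
    Finset.card_compl]

theorem sign_eq_neg_one_pow_permCyc {n : ℕ} (π : Equiv.Perm (Fin n)) :
    Equiv.Perm.sign π = (-1) ^ (permCyc π + n) := by
  have h : π.support.card ≤ n := by simpa using π.support.card_le_univ
  rw [Equiv.Perm.sign_of_cycleType, Equiv.Perm.sum_cycleType, permCyc, Equiv.Perm.parts_partition,
    Multiset.card_add, Multiset.card_replicate, Fintype.card_fin]
  rw [show Multiset.card π.cycleType + (n - π.support.card) + n =
    π.support.card + Multiset.card π.cycleType + 2 * (n - π.support.card) by omega, pow_add _ _
      (2 * _), pow_mul]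
  simp

/-- Removing a non-fixed point `x` from its cycle destroys that cycle exactly when it is a
transposition. -/
theorem card_cycleType_swap_mul {α : Type*} [Fintype α] [DecidableEq α] (g : Equiv.Perm α) {x : α}
    (hx : g x ≠ x) :
    Multiset.card (Equiv.swap x (g x) * g).cycleType + (if g (g x) = x then 1 else 0) =
      Multiset.card g.cycleType := by
  set c := g.cycleOf x with hc
  have hcc : c.IsCycle := Equiv.Perm.isCycle_cycleOf g hx
  have hmem : c ∈ g.cycleFactorsFinset :=
    Equiv.Perm.cycleOf_mem_cycleFactorsFinset_iff.2 (Equiv.Perm.mem_support.2 hx)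
  have hdisj : (g * c⁻¹).Disjoint c := Equiv.Perm.disjoint_mul_inv_of_mem_cycleFactorsFinset hmem
  have hg : g = c * (g * c⁻¹) := by rw [← hdisj.commute.eq]; group
  have hcx : c x = g x := Equiv.Perm.cycleOf_apply_self g x
  have hccx : c (g x) = g (g x) :=
    Equiv.Perm.SameCycle.cycleOf_apply (Equiv.Perm.sameCycle_apply_right.2 (.refl g x))
  have hcard : Multiset.card g.cycleType = 1 + Multiset.card (g * c⁻¹).cycleType := by
    conv_lhs => rw [hg, hdisj.symm.cycleType_mul, hcc.cycleType]
    simp [add_comm]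
  have hmul : Equiv.swap x (g x) * g = (Equiv.swap x (c x) * c) * (g * c⁻¹) := by
    rw [hcx, mul_assoc, ← hg]
  have hcx' : c x ≠ x := hcx ▸ hx
  rw [hcard, hmul]
  split_ifs with h
  · have h1 : Equiv.swap x (c x) * c = 1 := by
      have := hcc.eq_swap_of_apply_apply_eq_self hcx' (by rw [hcx, hccx, h])
      nth_rw 2 [this]
      simp
    rw [h1, one_mul, add_comm]
  · have h2 : (Equiv.swap x (c x) * c).IsCycle := hcc.swap_mul hcx' (by rwa [hcx, hccx])
    have h3 : (Equiv.swap x (c x) * c).Disjoint (g * c⁻¹) := by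
      intro y
      rcases hdisj y with hy | hy
      · exact Or.inr hy
      · left
        by_contra hne
        exact (Equiv.Perm.ne_and_ne_of_swap_mul_apply_ne_self hne).1 hy
    rw [h3.cycleType_mul, h2.cycleType]
    simp [add_comm]

section decomposeFin

/-! `decomposeFin.symm (0, e)` is `e` with a new fixed point `0`, and `decomposeFin.symm (j.succ, e)`
is `e` with `0` inserted into its cycle just before `j`. The arrow `e⁻¹ j → j` becomes
`e⁻¹ j → 0 → j`, which adds an excedance unless `e⁻¹ j` was one already. -/

open Equiv.Perm

variable {n : ℕ} (e : Equiv.Perm (Fin n)) (j : Fin n)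

theorem cycleType_decomposeFin_symm_zero :
    (decomposeFin.symm (0, e)).cycleType = e.cycleType := by
  rw [← cycleType_extendDomain (finSuccAboveEquiv (0 : Fin (n + 1))) (g := e)]
  congr 1
  ext i
  refine Fin.cases ?_ (fun i => ?_) i
  · rw [decomposeFin_symm_apply_zero, extendDomain_apply_not_subtype _ _ (by simp)]
  · have := extendDomain_apply_image e (finSuccAboveEquiv (0 : Fin (n + 1))) i
    simp [finSuccAboveEquiv_apply] at this
    rw [this, decomposeFin_symm_apply_succ]
    simp

theorem decomposeFin_symm_succ_apply_succ (i : Fin n) :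
    decomposeFin.symm (j.succ, e) i.succ = if e i = j then 0 else (e i).succ := by
  rw [decomposeFin_symm_apply_succ]
  split_ifs with h
  · rw [h, Equiv.swap_apply_right]
  · exact Equiv.swap_apply_of_ne_of_ne (Fin.succ_ne_zero _) (by simpa using h)

theorem fixedPoints_card_decomposeFin_symm_zero :
    Finset.card {i | decomposeFin.symm (0, e) i = i} = Finset.card {i | e i = i} + 1 := by
  rw [Fin.card_filter_univ_succ]
  simp

theorem fixedPoints_card_decomposeFin_symm_succ :
    Finset.card {i | decomposeFin.symm (j.succ, e) i = i} + (if e j = j then 1 else 0) =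
      Finset.card {i | e i = i} := by
  have h : ∀ i : Fin n, decomposeFin.symm (j.succ, e) i.succ = i.succ ↔ e i = i ∧ i ≠ j := by
    intro i
    rw [decomposeFin_symm_succ_apply_succ]
    split_ifs with h
    · simpa [(Fin.succ_ne_zero _).symm] using fun h' => h'.symm.trans h
    · simp only [Fin.succ_inj, ne_eq, iff_self_and]
      rintro h' rfl
      exact h h'
  rw [Fin.card_filter_univ_succ]
  simp only [h, decomposeFin_symm_apply_zero, Fin.succ_ne_zero, if_false]
  rw [← Finset.filter_filter, Finset.filter_ne']
  split_ifs with hj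
  · exact Finset.card_erase_add_one (by simpa using hj)
  · rw [Finset.erase_eq_of_notMem (by simpa using hj), add_zero]

theorem permExc_decomposeFin_symm_zero : permExc (decomposeFin.symm (0, e)) = permExc e := by
  rw [permExc, Fin.card_filter_univ_succ]
  simp [permExc]

theorem permExc_decomposeFin_symm_succ :
    permExc (decomposeFin.symm (j.succ, e)) + (if e.symm j < j then 1 else 0) = permExc e + 1 := by
  have h : ∀ i : Fin n, i.succ < decomposeFin.symm (j.succ, e) i.succ ↔
      i < e i ∧ i ≠ e.symm j := by
    intro i
    rw [decomposeFin_symm_succ_apply_succ, ne_eq, Equiv.eq_symm_apply]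
    split_ifs with h <;> simp [h]
  rw [permExc, Fin.card_filter_univ_succ]
  simp only [h, decomposeFin_symm_apply_zero, Fin.succ_pos, if_true]
  rw [← Finset.filter_filter, Finset.filter_ne']
  split_ifs with hj
  · rw [add_right_comm, Finset.card_erase_add_one (by simpa using hj), permExc]
  · rw [Finset.erase_eq_of_notMem (by simpa using hj), add_zero, permExc]

theorem permCyc_decomposeFin_symm_zero : permCyc (decomposeFin.symm (0, e)) = permCyc e + 1 := by
  rw [permCyc_eq, permCyc_eq, cycleType_decomposeFin_symm_zero,
    fixedPoints_card_decomposeFin_symm_zero, add_assoc]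

theorem permCyc_decomposeFin_symm_succ : permCyc (decomposeFin.symm (j.succ, e)) = permCyc e := by
  have h0 : decomposeFin.symm (j.succ, e) 0 = j.succ := decomposeFin_symm_apply_zero _ _
  have h := card_cycleType_swap_mul (decomposeFin.symm (j.succ, e)) (x := 0)
    (by rw [h0]; exact Fin.succ_ne_zero _)
  have hswap : Equiv.swap 0 j.succ * decomposeFin.symm (j.succ, e) = decomposeFin.symm (0, e) := by
    ext i
    refine Fin.cases ?_ (fun i => ?_) i <;> simp
  have hfix := fixedPoints_card_decomposeFin_symm_succ e j
  rw [h0, hswap, cycleType_decomposeFin_symm_zero, decomposeFin_symm_succ_apply_succ] at h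
  rw [permCyc_eq, permCyc_eq, ← hfix, ← h]
  by_cases hj : e j = j <;> simp [hj]
  omega

end decomposeFin

/-! ### Gamma-positivity for cycles -/

/-- The polynomial of the pair (cycles, excedances) over the permutations with exactly `k` fixed
points. -/
noncomputable def cycExcPoly (n k : ℕ) : ℤ[X][X] :=
  statExcPoly permCyc ({π | Finset.card {i | π i = i} = k} : Finset (Equiv.Perm (Fin n)))

theorem cycExcPoly_eq_zero_of_lt {n k : ℕ} (h : n < k) : cycExcPoly n k = 0 := by
  rw [cycExcPoly, statExcPoly, Finset.filter_eq_empty_iff.2, Finset.sum_empty]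
  intro π _ hπ
  have := Finset.card_le_univ ({i | π i = i} : Finset (Fin n))
  rw [Fintype.card_fin] at this
  omega

/-- The contribution of all insertions of a new smallest element into a cycle of `e`, sorted by the
number of fixed points of `e`. -/
theorem sum_insertions {n k : ℕ} (e : Equiv.Perm (Fin n)) :
    (∑ j : Fin n, if Finset.card {i | Equiv.Perm.decomposeFin.symm (j.succ, e) i = i} = k then
      C ((X : ℤ[X]) ^ permCyc (Equiv.Perm.decomposeFin.symm (j.succ, e))) *
        (X : ℤ[X][X]) ^ permExc (Equiv.Perm.decomposeFin.symm (j.succ, e)) else 0) =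
    C ((X : ℤ[X]) ^ permCyc e) *
      ((if Finset.card {i | e i = i} = k then
        (permExc e : ℤ[X][X]) * X ^ permExc e +
          ((n : ℤ[X][X]) - (permExc e : ℤ[X][X]) - (k : ℤ[X][X])) * X ^ (permExc e + 1) else 0) +
      (if Finset.card {i | e i = i} = k + 1 then
        ((k + 1 : ℕ) : ℤ[X][X]) * X ^ (permExc e + 1) else 0)) := by
  have hexc : Finset.card {j | e.symm j < j} = permExc e := by
    rw [permExc]
    exact Finset.card_bij' (fun j _ => e.symm j) (fun i _ => e i) (by simp) (by simp) (by simp)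
      (by simp)
  -- A generic insertion gives `t ^ (exc e + 1)`; the other two summands correct this for those `j`
  -- that are the value of an excedance and for those that are fixed.
  have hterm : ∀ j : Fin n,
      (if Finset.card {i | Equiv.Perm.decomposeFin.symm (j.succ, e) i = i} = k then
      C ((X : ℤ[X]) ^ permCyc (Equiv.Perm.decomposeFin.symm (j.succ, e))) *
        (X : ℤ[X][X]) ^ permExc (Equiv.Perm.decomposeFin.symm (j.succ, e)) else 0) =
      C ((X : ℤ[X]) ^ permCyc e) *
      ((if Finset.card {i | e i = i} = k then X ^ (permExc e + 1) else 0) +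
        (if e.symm j < j then
          if Finset.card {i | e i = i} = k then X ^ permExc e - X ^ (permExc e + 1) else 0 else 0) +
        (if e j = j then
          ((if Finset.card {i | e i = i} = k + 1 then X ^ (permExc e + 1) else 0) -
          (if Finset.card {i | e i = i} = k then X ^ (permExc e + 1) else 0)) else 0)) := by
    intro j
    have h1 := permExc_decomposeFin_symm_succ e j
    have h2 := fixedPoints_card_decomposeFin_symm_succ e j
    rw [permCyc_decomposeFin_symm_succ]
    by_cases hj : e j = j
    · have hj' : e.symm j = j := by rw [Equiv.symm_apply_eq, hj]
      simp only [hj', lt_irrefl, if_false, add_zero] at h1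
      simp only [hj, if_true] at h2
      rw [h1, hj', ← h2]
      simp [hj]
    · simp only [hj, if_false, add_zero] at h2
      rw [h2]
      by_cases hlt : e.symm j < j
      · simp only [hlt, if_true, add_left_inj] at h1
        rw [h1]
        simp only [hlt, hj, if_true, if_false]
        split_ifs <;> ring
      · simp only [hlt, if_false, add_zero] at h1
        rw [h1]
        simp only [hlt, hj, if_false]
        split_ifs <;> ring
  rw [Finset.sum_congr rfl fun j _ => hterm j, ← Finset.mul_sum]
  congr 1
  rw [Finset.sum_add_distrib, Finset.sum_add_distrib, ← Finset.sum_filter (fun j => e.symm j < j),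
    ← Finset.sum_filter (fun j => e j = j)]
  simp only [Finset.sum_const, hexc, Finset.card_univ, Fintype.card_fin, nsmul_eq_mul]
  by_cases hk : Finset.card {i | e i = i} = k
  · simp [hk]; ring
  · by_cases hk' : Finset.card {i | e i = i} = k + 1
    · simp [hk']
    · simp [hk, hk']

/-- Insertion of a new smallest element into a permutation with `k` fixed points: as a fixed point,
next to a non-fixed point, or into a fixed point, which becomes a transposition. -/
theorem cycExcPoly_succ (n k : ℕ) :
    cycExcPoly (n + 1) k = (if k = 0 then 0 else C X * cycExcPoly n (k - 1)) +
      ((((n : ℤ[X][X]) - (k : ℤ[X][X])) * X * cycExcPoly n k +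
        X * (1 - X) * derivative (cycExcPoly n k)) +
        (k + 1) • (X * cycExcPoly n (k + 1))) := by
  simp only [cycExcPoly, statExcPoly, Finset.sum_filter]
  rw [← Equiv.Perm.decomposeFin.symm.sum_comp, Fintype.sum_prod_type, Fin.sum_univ_succ]
  congr 1
  · simp only [fixedPoints_card_decomposeFin_symm_zero, permCyc_decomposeFin_symm_zero,
      permExc_decomposeFin_symm_zero]
    rcases k with _ | k
    · simp
    · simp [Finset.mul_sum, pow_succ', mul_assoc]
  · rw [Finset.sum_comm, derivative_sum, Finset.mul_sum, Finset.mul_sum, Finset.mul_sum,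
      Finset.smul_sum, ← Finset.sum_add_distrib, ← Finset.sum_add_distrib]
    refine Finset.sum_congr rfl fun e _ => ?_
    rw [sum_insertions]
    have hX : (X : ℤ[X][X]) * derivative (X ^ permExc e) =
        (permExc e : ℤ[X][X]) * X ^ permExc e := by
      rcases permExc e with _ | i
      · simp
      · simp; ring
    have hd : derivative (C ((X : ℤ[X]) ^ permCyc e) * (X : ℤ[X][X]) ^ permExc e) =
        C ((X : ℤ[X]) ^ permCyc e) * derivative ((X : ℤ[X][X]) ^ permExc e) := derivative_C_mul _ _
    by_cases hk : Finset.card {i | e i = i} = k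
    · simp only [hk, if_true, hd]
      simp only [Nat.left_eq_add, one_ne_zero, if_false, mul_zero, smul_zero]
      linear_combination (-(1 - X) * C ((X : ℤ[X]) ^ permCyc e)) * hX
    · by_cases hk' : Finset.card {i | e i = i} = k + 1
      · simp [hk']; ring
      · simp [hk, hk']

theorem cycExcPoly_mem_gammaCone (n k m : ℕ) (h : n = k + m) : cycExcPoly n k ∈ gammaCone m := by
  induction n generalizing k m with
  | zero =>
    obtain ⟨rfl, rfl⟩ : k = 0 ∧ m = 0 := by omega
    convert gamma_mem_gammaCone (b := 1) (i := 0) (j := 0) (m := 0) _ rfl using 1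
    · simp [cycExcPoly, statExcPoly, permCyc_eq, permExc]
    · intro k
      rw [coeff_one]
      split_ifs <;> simp
  | succ n ih =>
    rw [cycExcPoly_succ]
    refine add_mem ?_ (add_mem ?_ (nsmul_mem ?_ _))
    · split_ifs with hk
      · exact zero_mem _
      · exact C_X_mul_mem_gammaCone (ih _ _ (by omega))
    · rcases m with _ | m
      · simp [cycExcPoly_eq_zero_of_lt (show n < k by omega)]
      · obtain rfl : n = k + m := by omega
        convert eulerian_operator_mem_gammaCone (ih k m rfl) using 4
        push_cast; ring
    · rcases m with _ | _ | m
      · simp [cycExcPoly_eq_zero_of_lt (show n < k + 1 by omega)]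
      · simp [cycExcPoly_eq_zero_of_lt (show n < k + 1 by omega)]
      · exact X_mul_mem_gammaCone (ih _ _ (by omega))

theorem statExcPoly_permCyc_derangements_mem_gammaCone (n : ℕ) :
    statExcPoly permCyc ({π | π ∈ derangements (Fin n)} : Finset (Equiv.Perm (Fin n))) ∈
      gammaCone n := by
  convert cycExcPoly_mem_gammaCone n 0 n (by omega) using 1
  rw [cycExcPoly]
  congr 1
  ext π
  rw [Finset.mem_filter, Finset.mem_filter, Finset.card_eq_zero, Finset.filter_eq_empty_iff]
  exact and_congr_right fun _ => ⟨fun h i _ => h i, fun h i => h (Finset.mem_univ i)⟩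

/-! ### A q-rook identity -/

/-- The `q`-integer `1 + q + ... + q ^ (k - 1)`. -/
noncomputable def qInt (k : ℕ) : ℤ[X] := ∑ a ∈ Finset.range k, X ^ a

theorem permInv_eq_sum {n : ℕ} (π : Equiv.Perm (Fin n)) :
    permInv π = ∑ i, ∑ j, if i < j ∧ π j < π i then 1 else 0 := by
  rw [permInv, Finset.card_filter, Fintype.sum_prod_type]

/-- The permutation of `Fin (m + 1)` whose one-line notation is `p` followed by that of `e`,
standardised to the remaining values. -/
def permCons {m : ℕ} (p : Fin (m + 1)) (e : Equiv.Perm (Fin m)) : Equiv.Perm (Fin (m + 1)) :=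
  p.cycleRange.symm * Equiv.Perm.decomposeFin.symm (0, e)

theorem permCons_zero {m : ℕ} (p : Fin (m + 1)) (e : Equiv.Perm (Fin m)) :
    permCons p e 0 = p := by
  simp [permCons]

theorem permCons_succ {m : ℕ} (p : Fin (m + 1)) (e : Equiv.Perm (Fin m)) (j : Fin m) :
    permCons p e j.succ = p.succAbove (e j) := by
  simp [permCons]

theorem permCons_bijective (m : ℕ) :
    Function.Bijective fun x : Fin (m + 1) × Equiv.Perm (Fin m) => permCons x.1 x.2 := by
  rw [Fintype.bijective_iff_injective_and_card]
  refine ⟨?_, by simp [Fintype.card_perm, Nat.factorial_succ]⟩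
  rintro ⟨p, e⟩ ⟨p', e'⟩ h
  obtain rfl : p = p' := by
    simpa [permCons_zero] using congrArg (fun f : Equiv.Perm (Fin (m + 1)) => f 0) h
  have he : e = e' := by
    ext j : 1
    simpa [permCons_succ] using congrArg (fun f : Equiv.Perm (Fin (m + 1)) => f j.succ) h
  rw [he]

theorem permInv_permCons {m : ℕ} (p : Fin (m + 1)) (e : Equiv.Perm (Fin m)) :
    permInv (permCons p e) = p + permInv e := by
  have hp : ∑ j : Fin m, (if p.succAbove (e j) < p then 1 else 0) = (p : ℕ) := by
    rw [Equiv.sum_comp e fun j => if p.succAbove j < p then 1 else 0, ← Finset.card_filter]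
    simp only [Fin.succAbove_lt_iff_castSucc_lt]
    simp only [Fin.lt_def, Fin.val_castSucc]
    rw [Fin.card_filter_val_lt]
    exact min_eq_right (Nat.lt_succ_iff.1 p.2)
  rw [permInv_eq_sum, permInv_eq_sum, Fin.sum_univ_succ]
  simp only [Fin.sum_univ_succ, permCons_zero, permCons_succ, Fin.succ_lt_succ_iff,
    (Fin.strictMono_succAbove p).lt_iff_lt, Fin.succ_pos, Fin.not_lt_zero, true_and, false_and,
    if_false, zero_add, hp, lt_irrefl]

/-- Rook placements in a Ferrers board, counted by inversions: the value at the first position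
can be chosen in `c 0` ways, after which `c j - 1` values remain available at every later `j`. -/
theorem sum_qpow_permInv_of_lt {m : ℕ} (c : Fin m → ℕ) (hc : Monotone c) (hm : ∀ j, c j ≤ m) :
    (∑ τ : Equiv.Perm (Fin m), if ∀ j, (τ j : ℕ) < c j then (X : ℤ[X]) ^ permInv τ else 0) =
      ∏ j, qInt (c j - j) := by
  induction m with
  | zero => simp [permInv]
  | succ m ih =>
    have hiff : ∀ (p : Fin (m + 1)) (e : Equiv.Perm (Fin m)),
        (∀ j, (permCons p e j : ℕ) < c j) ↔
          (p : ℕ) < c 0 ∧ ∀ j : Fin m, (e j : ℕ) < c j.succ - 1 := by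
      intro p e
      rw [Fin.forall_fin_succ]
      simp only [permCons_zero, permCons_succ]
      refine and_congr_right fun hp => forall_congr' fun j => ?_
      have := hc (Fin.zero_le j.succ)
      rw [Fin.succAbove]
      split_ifs with h
      · rw [Fin.lt_def] at h
        simp only [Fin.val_castSucc] at h ⊢
        omega
      · rw [Fin.val_succ]
        omega
    rw [← (permCons_bijective m).sum_comp, Fintype.sum_prod_type, Fin.prod_univ_succ]
    simp only [hiff, permInv_permCons, ite_and, Fin.val_zero, Nat.sub_zero, Fin.val_succ]
    have hprod := ih (fun j => c j.succ - 1)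
      (fun i j hij => Nat.sub_le_sub_right (hc (Fin.succ_le_succ_iff.2 hij)) 1)
      (fun j => by have := hm j.succ; omega)
    have hq : qInt (c 0) = ∑ p : Fin (m + 1), if (p : ℕ) < c 0 then X ^ (p : ℕ) else 0 := by
      rw [Fin.sum_univ_eq_sum_range (fun p => if p < c 0 then (X : ℤ[X]) ^ p else 0),
        ← Finset.sum_filter, qInt]
      congr 1
      ext a
      have := hm 0
      simp only [Finset.mem_range, Finset.mem_filter]
      omega
    simp only [Nat.sub_sub, add_comm 1] at hprod
    rw [← hprod, hq, Finset.sum_mul_sum]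
    refine Finset.sum_congr rfl fun p _ => ?_
    split_ifs
    · refine Finset.sum_congr rfl fun e _ => ?_
      split_ifs <;> simp [pow_add]
    · simp

theorem permInv_rev_conj {m : ℕ} (τ : Equiv.Perm (Fin m)) :
    permInv ((Fin.revPerm.trans τ).trans Fin.revPerm) = permInv τ := by
  rw [permInv, permInv]
  exact Finset.card_bij' (fun x _ => (x.2.rev, x.1.rev)) (fun x _ => (x.2.rev, x.1.rev))
    (by simp) (by simp) (by simp) (by simp)

/-- The mirror image of `sum_qpow_permInv_of_lt` under the reversal of positions and values. -/
theorem sum_qpow_permInv_of_rev_lt {m : ℕ} (c : Fin m → ℕ) (hc : Antitone c) (hm : ∀ j, c j ≤ m) :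
    (∑ τ : Equiv.Perm (Fin m), if ∀ j, ((τ j).rev : ℕ) < c j then (X : ℤ[X]) ^ permInv τ else 0) =
      ∏ j, qInt (c j - j.rev) := by
  have h := sum_qpow_permInv_of_lt (fun j => c j.rev)
    (fun i j hij => hc (Fin.rev_le_rev.2 hij)) (fun j => hm _)
  rw [← Equiv.prod_comp Fin.revPerm] at h
  simp only [Fin.revPerm_apply, Fin.rev_rev] at h
  rw [← h, ← (Equiv.equivCongr (Fin.revPerm (n := m)) Fin.revPerm).sum_comp]
  refine Finset.sum_congr rfl fun τ _ => ?_
  have hconj : Equiv.equivCongr (Fin.revPerm (n := m)) Fin.revPerm τ =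
      (Fin.revPerm.trans τ).trans Fin.revPerm := by
    ext; simp
  rw [hconj, permInv_rev_conj]
  refine if_congr ⟨fun h j => ?_, fun h j => ?_⟩ rfl rfl
  · simpa using h j.rev
  · simpa using h j.rev

/-! ### Bijections between two subsets of a linear order -/

theorem card_filter_orderEmbOfFin {α : Type*} [LinearOrder α] {A : Finset α} {m : ℕ}
    (h : A.card = m) (P : α → Prop) [DecidablePred P] :
    Finset.card {i | P (A.orderEmbOfFin h i)} = Finset.card {a ∈ A | P a} := by
  conv_rhs => rw [← Finset.map_orderEmbOfFin_univ A h, Finset.filter_map, Finset.card_map]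
  rfl

/-- The elements of `A` below `x` form an initial segment in the increasing enumeration of `A`, so
comparisons between elements of two sets become conditions of the shape `τ j < c j`. -/
theorem orderEmbOfFin_lt_iff {α : Type*} [LinearOrder α] {A : Finset α} {m : ℕ}
    (h : A.card = m) (i : Fin m) (x : α) :
    A.orderEmbOfFin h i < x ↔ (i : ℕ) < Finset.card {a ∈ A | a < x} := by
  rw [← card_filter_orderEmbOfFin h]
  constructor
  · intro hi
    rw [← Nat.add_one_le_iff, ← Fin.card_Iic i]
    refine Finset.card_le_card fun j hj => ?_
    simpa using (OrderEmbedding.monotone _ (Finset.mem_Iic.1 hj)).trans_lt hi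
  · contrapose!
    intro hi
    rw [← Fin.card_Iio i]
    refine Finset.card_le_card fun j hj => ?_
    simp only [Finset.mem_filter, Finset.mem_univ, true_and] at hj
    simpa using hj.trans_le hi

theorem lt_orderEmbOfFin_iff {α : Type*} [LinearOrder α] {A : Finset α} {m : ℕ}
    (h : A.card = m) (i : Fin m) (x : α) :
    x < A.orderEmbOfFin h i ↔ (i.rev : ℕ) < Finset.card {a ∈ A | x < a} := by
  rw [← card_filter_orderEmbOfFin h]
  have hr : (i.rev : ℕ) = m - 1 - i := by rw [Fin.val_rev]; omega
  have hlt := i.2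
  constructor
  · intro hi
    have hc : m - i ≤ Finset.card {j | x < A.orderEmbOfFin h j} :=
      (Fin.card_Ici i).symm.trans_le (Finset.card_le_card fun j hj => by
      simpa using hi.trans_le (OrderEmbedding.monotone _ (Finset.mem_Ici.1 hj)))
    exact lt_of_lt_of_le (by omega) hc
  · contrapose!
    intro hi
    rw [hr, ← Fin.card_Ioi i]
    refine Finset.card_le_card fun j hj => ?_
    simp only [Finset.mem_filter, Finset.mem_univ, true_and] at hj
    simpa using hi.trans_lt hj

theorem card_lt_orderEmbOfFin {α : Type*} [LinearOrder α] {A : Finset α} {m : ℕ}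
    (h : A.card = m) (j : Fin m) :
    Finset.card {a ∈ A | a < A.orderEmbOfFin h j} = j := by
  have h1 := (orderEmbOfFin_lt_iff h j (A.orderEmbOfFin h j)).not.1 (lt_irrefl _)
  by_contra hne
  have hj := j.2
  have h2 := orderEmbOfFin_lt_iff h
    ⟨Finset.card {a ∈ A | a < A.orderEmbOfFin h j}, by omega⟩ (A.orderEmbOfFin h j)
  rw [OrderEmbedding.lt_iff_lt, Fin.lt_def] at h2
  simp only [lt_irrefl, iff_false] at h2
  omega

theorem card_gt_orderEmbOfFin {α : Type*} [LinearOrder α] {A : Finset α} {m : ℕ}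
    (h : A.card = m) (j : Fin m) :
    Finset.card {a ∈ A | A.orderEmbOfFin h j < a} = j.rev := by
  have h1 := (lt_orderEmbOfFin_iff h j (A.orderEmbOfFin h j)).not.1 (lt_irrefl _)
  by_contra hne
  have hj := j.rev.2
  have h2 := lt_orderEmbOfFin_iff h
    (⟨Finset.card {a ∈ A | A.orderEmbOfFin h j < a}, by omega⟩ : Fin m).rev (A.orderEmbOfFin h j)
  rw [OrderEmbedding.lt_iff_lt, ← Fin.rev_lt_rev, Fin.rev_rev, Fin.lt_def] at h2
  simp only [lt_irrefl, iff_false] at h2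
  omega

theorem prod_orderEmbOfFin {α M : Type*} [LinearOrder α] [CommMonoid M] {A : Finset α} {m : ℕ}
    (h : A.card = m) (f : α → M) : ∏ j, f (A.orderEmbOfFin h j) = ∏ a ∈ A, f a := by
  conv_rhs => rw [← Finset.map_orderEmbOfFin_univ A h, Finset.prod_map]
  rfl

/-- Bijections from `V` to `E`, encoded as permutations of the ranks of their elements,
that decrease every element, counted by inversions. -/
theorem sum_qpow_permInv_decreasing {α : Type*} [LinearOrder α] {E V : Finset α} {m : ℕ}
    (hE : E.card = m) (hV : V.card = m) :
    (∑ τ : Equiv.Perm (Fin m), if ∀ j, E.orderEmbOfFin hE (τ j) < V.orderEmbOfFin hV j then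
      (X : ℤ[X]) ^ permInv τ else 0) =
      ∏ v ∈ V, qInt (Finset.card {a ∈ E | a < v} - Finset.card {a ∈ V | a < v}) := by
  simp only [orderEmbOfFin_lt_iff]
  rw [sum_qpow_permInv_of_lt, ← prod_orderEmbOfFin hV]
  · simp only [card_lt_orderEmbOfFin]
  · intro i j hij
    refine Finset.card_le_card fun a ha => ?_
    rw [Finset.mem_filter] at ha ⊢
    exact ⟨ha.1, ha.2.trans_le (OrderEmbedding.monotone _ hij)⟩
  · exact fun j => (Finset.card_filter_le _ _).trans hE.le

/-- Bijections from `V` to `E`, encoded as permutations of the ranks of their elements,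
that increase every element, counted by inversions. -/
theorem sum_qpow_permInv_increasing {α : Type*} [LinearOrder α] {E V : Finset α} {m : ℕ}
    (hE : E.card = m) (hV : V.card = m) :
    (∑ τ : Equiv.Perm (Fin m), if ∀ j, V.orderEmbOfFin hV j < E.orderEmbOfFin hE (τ j) then
      (X : ℤ[X]) ^ permInv τ else 0) =
      ∏ v ∈ V, qInt (Finset.card {a ∈ E | v < a} - Finset.card {a ∈ V | v < a}) := by
  simp only [lt_orderEmbOfFin_iff]
  rw [sum_qpow_permInv_of_rev_lt, ← prod_orderEmbOfFin hV]
  · simp only [card_gt_orderEmbOfFin]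
  · intro i j hij
    refine Finset.card_le_card fun a ha => ?_
    rw [Finset.mem_filter] at ha ⊢
    exact ⟨ha.1, (OrderEmbedding.monotone _ hij).trans_lt ha.2⟩
  · exact fun j => (Finset.card_filter_le _ _).trans hE.le

/-! ### Derangements with prescribed anti-excedances -/

/-- `V` is the set of positions `v` of `p` with `p v < v`, all other positions satisfy `v < p v`,
and `E` is the set of the values of `p` at `V`. -/
def HasAntiexcedances {n : ℕ} (E V : Finset (Fin n)) (p : Equiv.Perm (Fin n)) : Prop :=
  (∀ v ∈ V, p v < v) ∧ (∀ v ∉ V, v < p v) ∧ ∀ v, p v ∈ E ↔ v ∈ V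

instance {n : ℕ} (E V : Finset (Fin n)) : DecidablePred (HasAntiexcedances E V) :=
  fun _ => inferInstanceAs (Decidable (_ ∧ _))

/-- The inversion polynomial of the derangements with prescribed anti-excedance positions `V` and
values `E`. -/
noncomputable def antiexcInvPoly {n : ℕ} (E V : Finset (Fin n)) : ℤ[X] :=
  ∑ p with HasAntiexcedances E V p, X ^ permInv p

/-- The number of pairs `u < v` with `u ∉ A` and `v ∈ A`. The difference of its values at the sets
of positions and of values of the anti-excedances is the number of inversions between an
anti-excedance and an excedance. -/
def coInv {n : ℕ} (A : Finset (Fin n)) : ℕ :=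
  ∑ u, ∑ v, if u ∉ A ∧ v ∈ A ∧ u < v then 1 else 0

theorem card_eq_of_hasAntiexcedances {n : ℕ} {E V : Finset (Fin n)} {p : Equiv.Perm (Fin n)}
    (h : HasAntiexcedances E V p) : E.card = V.card := by
  have : V.map p.toEmbedding = E := by
    ext x
    rw [Finset.mem_map_equiv, ← h.2.2, Equiv.apply_symm_apply]
  rw [← this, Finset.card_map]

theorem antiexcInvPoly_eq_zero {n : ℕ} {E V : Finset (Fin n)} (h : E.card ≠ V.card) :
    antiexcInvPoly E V = 0 := by
  rw [antiexcInvPoly, Finset.filter_eq_empty_iff.2, Finset.sum_empty]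
  exact fun p _ hp => h (card_eq_of_hasAntiexcedances hp)

/-- Among the pairs formed by an anti-excedance `v` and an excedance `u`, only those with `u < v`
can be inversions, and those of them that are not are the pairs with `p u < p v`. -/
theorem permInv_add_coInv {n : ℕ} {E V : Finset (Fin n)} {p : Equiv.Perm (Fin n)}
    (h : HasAntiexcedances E V p) :
    permInv p + coInv E =
      (∑ u, ∑ v, if (u ∈ V ↔ v ∈ V) ∧ u < v ∧ p v < p u then 1 else 0) + coInv V := by
  have hE : coInv E = ∑ u, ∑ v, if p u ∉ E ∧ p v ∈ E ∧ p u < p v then 1 else 0 := by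
    rw [coInv, ← Equiv.sum_comp p]
    exact Finset.sum_congr rfl fun u _ => (Equiv.sum_comp p _).symm
  rw [hE, permInv_eq_sum, coInv, ← Finset.sum_add_distrib, ← Finset.sum_add_distrib]
  refine Finset.sum_congr rfl fun u _ => ?_
  rw [← Finset.sum_add_distrib, ← Finset.sum_add_distrib]
  refine Finset.sum_congr rfl fun v _ => ?_
  simp only [h.2.2]
  obtain ⟨h1, h2, -⟩ := h
  by_cases hu : u ∈ V <;> by_cases hv : v ∈ V
  · simp [hu, hv]
  · have hu' := h1 u hu
    have hv' := h2 v hv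
    simp only [hu, hv]
    simp
    intro _
    order
  · have hu' := h2 u hu
    have hv' := h1 v hv
    simp only [hu, hv, not_false_eq_true, true_and, false_iff, not_true_eq_false, false_and,
      if_false, zero_add]
    rcases lt_trichotomy (p u) (p v) with hlt | heq | hgt
    · have huv : u < v := by order
      simp [hlt, huv, hlt.not_gt]
    · exact absurd (p.injective heq ▸ hv) hu
    · simp [hgt, hgt.not_gt]
  · simp [hu, hv]

/-- The permutation that maps the `j`-th element of `V` to the `τ₁ j`-th element of `E`, and the
`j`-th element of the complement of `V` to the `τ₂ j`-th element of the complement of `E`. -/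
def permOfHalves {n m m' : ℕ} {E V : Finset (Fin n)} (hE : E.card = m) (hE' : Eᶜ.card = m')
    (hV : V.card = m) (hV' : Vᶜ.card = m') (τ : Equiv.Perm (Fin m) × Equiv.Perm (Fin m')) :
    Equiv.Perm (Fin n) :=
  ((finSumEquivOfFinset hV hV').symm.trans (Equiv.sumCongr τ.1 τ.2)).trans
    (finSumEquivOfFinset hE hE')

section permOfHalves

variable {n m m' : ℕ} {E V : Finset (Fin n)} (hE : E.card = m) (hE' : Eᶜ.card = m')
  (hV : V.card = m) (hV' : Vᶜ.card = m')

theorem permOfHalves_inl (τ : Equiv.Perm (Fin m) × Equiv.Perm (Fin m')) (j : Fin m) :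
    permOfHalves hE hE' hV hV' τ (V.orderEmbOfFin hV j) = E.orderEmbOfFin hE (τ.1 j) := by
  rw [← finSumEquivOfFinset_inl hV hV', ← finSumEquivOfFinset_inl hE hE', permOfHalves,
    Equiv.trans_apply, Equiv.trans_apply, Equiv.symm_apply_apply]
  rfl

theorem permOfHalves_inr (τ : Equiv.Perm (Fin m) × Equiv.Perm (Fin m')) (j : Fin m') :
    permOfHalves hE hE' hV hV' τ (Vᶜ.orderEmbOfFin hV' j) = Eᶜ.orderEmbOfFin hE' (τ.2 j) := by
  rw [← finSumEquivOfFinset_inr hV hV', ← finSumEquivOfFinset_inr hE hE', permOfHalves,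
    Equiv.trans_apply, Equiv.trans_apply, Equiv.symm_apply_apply]
  rfl

theorem permOfHalves_injective : Function.Injective (permOfHalves hE hE' hV hV') := by
  intro τ τ' h
  refine Prod.ext (Equiv.ext fun j => ?_) (Equiv.ext fun j => ?_)
  · have := congrArg (fun f : Equiv.Perm (Fin n) => f (V.orderEmbOfFin hV j)) h
    simpa [permOfHalves_inl] using this
  · have := congrArg (fun f : Equiv.Perm (Fin n) => f (Vᶜ.orderEmbOfFin hV' j)) h
    simpa [permOfHalves_inr] using this

theorem forall_iff_forall_orderEmbOfFin (P : Fin n → Prop) :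
    (∀ v, P v) ↔ (∀ j, P (V.orderEmbOfFin hV j)) ∧ ∀ j, P (Vᶜ.orderEmbOfFin hV' j) := by
  rw [← (finSumEquivOfFinset hV hV').forall_congr_right, Sum.forall]
  simp

theorem sum_eq_sum_orderEmbOfFin (f : Fin n → ℕ) :
    ∑ v, f v = (∑ j, f (V.orderEmbOfFin hV j)) + ∑ j, f (Vᶜ.orderEmbOfFin hV' j) := by
  rw [← (finSumEquivOfFinset hV hV').sum_comp, Fintype.sum_sum_type]
  simp

theorem orderEmbOfFin_compl_notMem (j : Fin m') : Vᶜ.orderEmbOfFin hV' j ∉ V :=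
  Finset.mem_compl.1 (Finset.orderEmbOfFin_mem _ _ _)

theorem hasAntiexcedances_permOfHalves_iff (τ : Equiv.Perm (Fin m) × Equiv.Perm (Fin m')) :
    HasAntiexcedances E V (permOfHalves hE hE' hV hV' τ) ↔
      (∀ j, E.orderEmbOfFin hE (τ.1 j) < V.orderEmbOfFin hV j) ∧
        ∀ j, Vᶜ.orderEmbOfFin hV' j < Eᶜ.orderEmbOfFin hE' (τ.2 j) := by
  rw [HasAntiexcedances, forall_iff_forall_orderEmbOfFin hV hV',
    forall_iff_forall_orderEmbOfFin hV hV', forall_iff_forall_orderEmbOfFin hV hV']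
  simp [permOfHalves_inl, permOfHalves_inr, Finset.orderEmbOfFin_mem, orderEmbOfFin_compl_notMem]

theorem exists_permOfHalves_eq {p : Equiv.Perm (Fin n)} (h : ∀ v, p v ∈ E ↔ v ∈ V) :
    ∃ τ, permOfHalves hE hE' hV hV' τ = p := by
  obtain ⟨τ, hτ⟩ := Equiv.Perm.mem_sumCongrHom_range_of_perm_mapsTo_inl
    (σ := ((finSumEquivOfFinset hV hV').trans p).trans (finSumEquivOfFinset hE hE').symm) (by
      rintro _ ⟨j, rfl⟩
      have hmem : p (V.orderEmbOfFin hV j) ∈ E := (h _).2 (Finset.orderEmbOfFin_mem _ _ _)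
      rw [← Finset.mem_coe, ← Finset.range_orderEmbOfFin E hE] at hmem
      obtain ⟨i, hi⟩ := hmem
      refine ⟨i, ?_⟩
      rw [Equiv.trans_apply, Equiv.trans_apply, Equiv.eq_symm_apply, finSumEquivOfFinset_inl,
        finSumEquivOfFinset_inl, hi])
  refine ⟨τ, ?_⟩
  have hτ' : Equiv.sumCongr τ.1 τ.2 =
      ((finSumEquivOfFinset hV hV').trans p).trans (finSumEquivOfFinset hE hE').symm := hτ
  rw [permOfHalves, hτ']
  ext x
  simp

theorem permInv_permOfHalves_add_coInv {τ : Equiv.Perm (Fin m) × Equiv.Perm (Fin m')}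
    (h : HasAntiexcedances E V (permOfHalves hE hE' hV hV' τ)) :
    permInv (permOfHalves hE hE' hV hV' τ) + coInv E =
      permInv τ.1 + permInv τ.2 + coInv V := by
  rw [permInv_add_coInv h, permInv_eq_sum τ.1, permInv_eq_sum τ.2,
    sum_eq_sum_orderEmbOfFin hV hV']
  simp only [sum_eq_sum_orderEmbOfFin hV hV']
  simp [permOfHalves_inl, permOfHalves_inr, Finset.orderEmbOfFin_mem, orderEmbOfFin_compl_notMem]

end permOfHalves

/-- The two `q`-rook counts of `sum_qpow_permInv_decreasing` and `sum_qpow_permInv_increasing`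
multiply up, since the number of inversions between the two halves depends only on `E` and `V`. -/
theorem antiexcInvPoly_mul {n : ℕ} {E V : Finset (Fin n)} (h : E.card = V.card) :
    antiexcInvPoly E V * X ^ coInv E =
      (∏ v ∈ V, qInt (Finset.card {a ∈ E | a < v} - Finset.card {a ∈ V | a < v})) *
      (∏ v ∈ Vᶜ, qInt (Finset.card {a ∈ Eᶜ | v < a} - Finset.card {a ∈ Vᶜ | v < a})) *
      X ^ coInv V := by
  have h' : Eᶜ.card = Vᶜ.card := by rw [Finset.card_compl, Finset.card_compl, h]
  rw [← sum_qpow_permInv_decreasing h rfl, ← sum_qpow_permInv_increasing h' rfl,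
    Finset.sum_mul_sum, ← Fintype.sum_prod_type', antiexcInvPoly, Finset.sum_filter,
    Finset.sum_mul, Finset.sum_mul]
  symm
  refine Finset.sum_of_injOn (permOfHalves h h' rfl rfl)
    (permOfHalves_injective h h' rfl rfl).injOn (fun _ _ => Finset.mem_coe.2 (Finset.mem_univ _))
    ?_ ?_
  · intro p _ hp
    rw [if_neg, zero_mul]
    intro hgood
    obtain ⟨τ, rfl⟩ := exists_permOfHalves_eq h h' rfl rfl hgood.2.2
    exact hp ⟨τ, by simp, rfl⟩
  · intro τ _
    by_cases hgood : HasAntiexcedances E V (permOfHalves h h' rfl rfl τ)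
    · rw [if_pos hgood, ← pow_add, permInv_permOfHalves_add_coInv h h' rfl rfl hgood]
      rw [hasAntiexcedances_permOfHalves_iff] at hgood
      rw [if_pos hgood.1, if_pos hgood.2, pow_add, pow_add]
    · rw [if_neg hgood]
      rw [hasAntiexcedances_permOfHalves_iff, not_and_or] at hgood
      rcases hgood with hgood | hgood <;> simp [if_neg hgood]

/-! ### Moving a position between excedances and anti-excedances -/

/-- In the comparison of two sets of equal size, the correction terms `A.card` and `k` cancel. -/
theorem coInv_insert {n : ℕ} {A : Finset (Fin n)} {k : Fin n} (hk : k ∉ A) :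
    coInv (insert k A) + A.card = coInv A + k := by
  -- The pairs `(k, v)` with `k < v ∈ A` are lost, and `(u, k)` with `k > u ∉ A` are gained.
  have hA : A.card = ∑ u, ∑ v, ((if u = k then (if v ∈ A ∧ k < v then 1 else 0) else 0) +
      if v = k then (if u ∈ A ∧ u < k then 1 else 0) else 0) := by
    simp only [Finset.sum_add_distrib, Finset.sum_ite_eq', Finset.mem_univ, if_true]
    rw [Finset.sum_comm]
    simp only [Finset.sum_ite_eq', Finset.mem_univ, if_true]
    rw [← Finset.sum_add_distrib]
    trans ∑ v, if v ∈ A then 1 else 0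
    · simp
    · refine Finset.sum_congr rfl fun v _ => ?_
      rcases lt_trichotomy v k with h | rfl | h
      · simp [h, h.not_gt]
      · simp [hk]
      · simp [h, h.not_gt]
  have hk' : (k : ℕ) = ∑ u : Fin n, ∑ v, if v = k then (if u < k then 1 else 0) else 0 := by
    simp only [Finset.sum_ite_eq', Finset.mem_univ, if_true]
    rw [← Finset.card_filter, ← Fin.card_Iio k]
    congr 1
    ext; simp
  rw [hA, coInv, coInv]
  conv_rhs => rw [hk']
  rw [← Finset.sum_add_distrib, ← Finset.sum_add_distrib]
  refine Finset.sum_congr rfl fun u _ => ?_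
  rw [← Finset.sum_add_distrib, ← Finset.sum_add_distrib]
  refine Finset.sum_congr rfl fun v _ => ?_
  by_cases hu : u = k
  · subst hu
    by_cases hv : v = u
    · subst hv; simp
    · simp [hv, hk]
  · by_cases hv : v = k
    · subst hv
      by_cases huA : u ∈ A <;> simp [hu, hk, huA]
    · simp [hu, hv]

theorem card_filter_insert_lt {n : ℕ} {A : Finset (Fin n)} {k : Fin n} (hk : k ∉ A) (v : Fin n) :
    Finset.card {a ∈ insert k A | a < v} =
      Finset.card {a ∈ A | a < v} + if k < v then 1 else 0 := by
  rw [Finset.filter_insert]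
  split_ifs
  · exact Finset.card_insert_of_notMem (by simp [hk])
  · rfl

theorem card_filter_compl_insert_gt {n : ℕ} {A : Finset (Fin n)} {k : Fin n} (hk : k ∉ A)
    (v : Fin n) :
    Finset.card {a ∈ (insert k A)ᶜ | v < a} + (if v < k then 1 else 0) =
      Finset.card {a ∈ Aᶜ | v < a} := by
  rw [Finset.compl_insert, Finset.filter_erase]
  split_ifs with h
  · exact Finset.card_erase_add_one (by simp [hk, h])
  · rw [Finset.erase_eq_of_notMem (by simp [h]), add_zero]

theorem card_filter_compl_gt {n : ℕ} {A : Finset (Fin n)} {k : Fin n} (hk : k ∉ A) :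
    Finset.card {a ∈ Aᶜ | k < a} + A.card =
      Finset.card (Finset.Ioi k) + Finset.card {a ∈ A | a < k} := by
  have h1 : Finset.card {a ∈ A | a < k} + Finset.card {a ∈ A | ¬ a < k} = A.card :=
    Finset.card_filter_add_card_filter_not _
  have h2 : Finset.card {a ∈ Finset.Ioi k | a ∈ A} + Finset.card {a ∈ Finset.Ioi k | a ∉ A} =
      Finset.card (Finset.Ioi k) :=
    Finset.card_filter_add_card_filter_not _
  have h3 : ({a ∈ Finset.Ioi k | a ∈ A} : Finset (Fin n)) = {a ∈ A | ¬ a < k} := by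
    ext a
    simp only [Finset.mem_filter, Finset.mem_Ioi, not_lt]
    refine ⟨fun h => ⟨h.2, h.1.le⟩, fun h => ⟨lt_of_le_of_ne h.2 ?_, h.1⟩⟩
    rintro rfl
    exact hk h.1
  have h4 : ({a ∈ Finset.Ioi k | a ∉ A} : Finset (Fin n)) = {a ∈ Aᶜ | k < a} := by
    ext a
    simp [and_comm]
  rw [h3, h4] at h2
  omega

/-- A position `k ∉ E ∪ V` contributes the factor `qInt (#{a ∈ Eᶜ | k < a} - #{a ∈ Vᶜ | k < a})` to
the product over `Vᶜ`. Inserted into `E` and `V`, it contributes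
`qInt (#{a ∈ E | a < k} - #{a ∈ V | a < k})` to the product over `V` instead, which is the same. -/
theorem antiexcInvPoly_insert {n : ℕ} {E V : Finset (Fin n)} {k : Fin n} (hE : k ∉ E)
    (hV : k ∉ V) : antiexcInvPoly (insert k E) (insert k V) = antiexcInvPoly E V := by
  have hEk := Finset.card_insert_of_notMem hE
  have hVk := Finset.card_insert_of_notMem hV
  by_cases hcard : E.card = V.card
  · have h0 := antiexcInvPoly_mul hcard
    have h1 := antiexcInvPoly_mul (show (insert k E).card = (insert k V).card by omega)
    have hkmem : k ∈ Vᶜ := by simpa using hV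
    have hlow : ∀ v ∈ V, Finset.card {a ∈ insert k E | a < v} -
        Finset.card {a ∈ insert k V | a < v} =
        Finset.card {a ∈ E | a < v} - Finset.card {a ∈ V | a < v} := by
      intro v _
      rw [card_filter_insert_lt hE, card_filter_insert_lt hV, Nat.add_sub_add_right]
    have hhigh : ∀ v ∈ Vᶜ.erase k, Finset.card {a ∈ (insert k E)ᶜ | v < a} -
        Finset.card {a ∈ (insert k V)ᶜ | v < a} =
        Finset.card {a ∈ Eᶜ | v < a} - Finset.card {a ∈ Vᶜ | v < a} := by
      intro v _
      rw [← card_filter_compl_insert_gt hE, ← card_filter_compl_insert_gt hV,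
        Nat.add_sub_add_right]
    have hmid : Finset.card {a ∈ Eᶜ | k < a} - Finset.card {a ∈ Vᶜ | k < a} =
        Finset.card {a ∈ E | a < k} - Finset.card {a ∈ V | a < k} := by
      have := card_filter_compl_gt hE
      have := card_filter_compl_gt hV
      omega
    rw [Finset.prod_insert hV, Finset.prod_congr rfl fun v hv => congrArg qInt (hlow v hv),
      Finset.prod_congr (Finset.compl_insert (s := V)) fun v hv => congrArg qInt (hhigh v hv),
      card_filter_insert_lt hE, card_filter_insert_lt hV, Nat.add_sub_add_right] at h1
    rw [← Finset.mul_prod_erase _ _ hkmem, hmid] at h0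
    have hcE := coInv_insert hE
    have hcV := coInv_insert hV
    refine mul_right_cancel₀ (pow_ne_zero (coInv E + k) (X_ne_zero (R := ℤ))) ?_
    have hV0 : (X : ℤ[X]) ^ coInv (insert k V) * X ^ E.card = X ^ coInv V * X ^ (k : ℕ) := by
      rw [← pow_add, ← pow_add, hcard, hcV]
    have hE0 : (X : ℤ[X]) ^ coInv (insert k E) * X ^ E.card = X ^ coInv E * X ^ (k : ℕ) := by
      rw [← pow_add, ← pow_add, hcE]
    rw [pow_add]
    linear_combination X ^ E.card * h1 - X ^ (k : ℕ) * h0 -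
      antiexcInvPoly (insert k E) (insert k V) * hE0 + ((∏ v ∈ V, qInt (Finset.card {a ∈ E | a < v} -
      Finset.card {a ∈ V | a < v})) * qInt (Finset.card {a ∈ E | a < k} -
      Finset.card {a ∈ V | a < k}) * ∏ v ∈ Vᶜ.erase k, qInt (Finset.card {a ∈ Eᶜ | v < a} -
      Finset.card {a ∈ Vᶜ | v < a})) * hV0
  · rw [antiexcInvPoly_eq_zero hcard, antiexcInvPoly_eq_zero (by omega)]

theorem antiexcInvPoly_union {n : ℕ} {E V : Finset (Fin n)} (S : Finset (Fin n))
    (hE : Disjoint E S) (hV : Disjoint V S) :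
    antiexcInvPoly (E ∪ S) (V ∪ S) = antiexcInvPoly E V := by
  induction S using Finset.induction_on with
  | empty => simp
  | insert k S hk ih =>
    rw [Finset.disjoint_insert_right] at hE hV
    rw [Finset.union_insert, Finset.union_insert, antiexcInvPoly_insert, ih hE.2 hV.2]
    · simp [hE.1, hk]
    · simp [hV.1, hk]

/-! ### Gamma-positivity for inversions -/

theorem coeff_antiexcInvPoly_nonneg {n : ℕ} (E V : Finset (Fin n)) (k : ℕ) :
    0 ≤ (antiexcInvPoly E V).coeff k := by
  rw [antiexcInvPoly, finsetSum_coeff]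
  refine Finset.sum_nonneg fun p _ => ?_
  rw [coeff_X_pow]
  split_ifs <;> simp

theorem permInv_inv {n : ℕ} (π : Equiv.Perm (Fin n)) : permInv π⁻¹ = permInv π := by
  rw [permInv, permInv]
  exact Finset.card_bij' (fun x _ => (π⁻¹ x.2, π⁻¹ x.1)) (fun x _ => (π x.2, π x.1))
    (by simp +contextual) (by simp +contextual) (by simp) (by simp)

theorem permExc_inv {n : ℕ} (π : Equiv.Perm (Fin n)) :
    permExc π⁻¹ = Finset.card {v | π v < v} := by
  rw [permExc]
  exact Finset.card_bij' (fun x _ => π⁻¹ x) (fun x _ => π x) (by simp) (by simp) (by simp) (by simp)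

theorem sign_eq_neg_one_pow_permInv {n : ℕ} (π : Equiv.Perm (Fin n)) :
    Equiv.Perm.sign π = (-1) ^ (permInv π + 0) := by
  rw [Equiv.Perm.sign_eq_prod_prod_Ioi, add_zero, permInv_eq_sum, ← Finset.prod_pow_eq_pow_sum]
  refine Finset.prod_congr rfl fun i _ => ?_
  rw [← Finset.prod_pow_eq_pow_sum, ← Finset.prod_filter_mul_prod_filter_not Finset.univ (i < ·)]
  rw [Finset.prod_eq_one (s := {j | ¬ i < j}) (by simp +contextual), mul_one]
  refine Finset.prod_congr (by ext; simp) fun j hj => ?_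
  have hij : i < j := by simpa using hj
  rcases lt_trichotomy (π i) (π j) with h | h | h
  · simp [h, h.not_gt]
  · exact absurd (π.injective h) hij.ne
  · simp [hij, h, h.not_gt]

/-- Every derangement has exactly one pair of sets of anti-excedance values and positions. -/
theorem statExcPoly_permInv_derangements (n : ℕ) :
    statExcPoly permInv ({π | π ∈ derangements (Fin n)} : Finset (Equiv.Perm (Fin n))) =
      ∑ x : Finset (Fin n) × Finset (Fin n), C (antiexcInvPoly x.1 x.2) * X ^ x.2.card := by
  have hiff : ∀ (p : Equiv.Perm (Fin n)) (x : Finset (Fin n) × Finset (Fin n)),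
      HasAntiexcedances x.1 x.2 p ↔ p ∈ derangements (Fin n) ∧
        x = (({v | p v < v} : Finset (Fin n)).map p.toEmbedding,
          ({v | p v < v} : Finset (Fin n))) := by
    rintro p ⟨E, V⟩
    constructor
    · rintro ⟨h1, h2, h3⟩
      have hV : V = ({v | p v < v} : Finset (Fin n)) := by
        ext v
        by_cases hv : v ∈ V
        · simp [hv, h1 v hv]
        · simp [hv, (h2 v hv).le]
      refine ⟨fun v hv => ?_, Prod.ext ?_ hV⟩
      · by_cases hvV : v ∈ V
        · exact (h1 v hvV).ne hv
        · exact (h2 v hvV).ne' hv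
      · rw [← hV]
        ext x
        rw [ Finset.mem_map_equiv, ← h3, Equiv.apply_symm_apply]
    · rintro ⟨hp, h⟩
      obtain ⟨rfl, rfl⟩ := Prod.ext_iff.1 h
      refine ⟨fun v hv => by simpa using hv, fun v hv => ?_, fun v => by simp⟩
      exact lt_of_le_of_ne (by simpa using hv) (Ne.symm (hp v))
  have hinv : ∀ p : Equiv.Perm (Fin n),
      p⁻¹ ∈ derangements (Fin n) ↔ p ∈ derangements (Fin n) := by
    intro p
    refine forall_congr' fun v => not_congr ?_
    rw [Equiv.Perm.inv_eq_iff_eq, eq_comm]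
  simp only [statExcPoly, antiexcInvPoly, map_sum, Finset.sum_mul, Finset.sum_filter]
  rw [Finset.sum_comm, ← Equiv.sum_comp (Equiv.inv (Equiv.Perm (Fin n)))]
  refine Finset.sum_congr rfl fun p _ => ?_
  simp only [Equiv.inv_apply, hinv, permInv_inv, permExc_inv, hiff, ite_and]
  split_ifs
  · simp only [apply_ite C, map_zero, ite_mul, zero_mul, Finset.sum_ite_eq', Finset.mem_univ,
      if_true]
  · simp

/-- Derangements are grouped by the sets `P` of positions and `R` of values that are left of their
anti-excedances after removal of the common elements `S`. All subsets `S` of the complement of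
`P ∪ R` contribute equally. -/
theorem statExcPoly_permInv_derangements_mem_gammaCone (n : ℕ) :
    statExcPoly permInv ({π | π ∈ derangements (Fin n)} : Finset (Equiv.Perm (Fin n))) ∈
      gammaCone n := by
  rw [statExcPoly_permInv_derangements, ← Finset.sum_fiberwise _ fun x => (x.1 \ x.2, x.2 \ x.1)]
  refine sum_mem ?_
  rintro ⟨R, P⟩ -
  by_cases hdisj : Disjoint R P
  · have hsum : (∑ x : Finset (Fin n) × Finset (Fin n) with (x.1 \ x.2, x.2 \ x.1) = (R, P),
        C (antiexcInvPoly x.1 x.2) * (X : ℤ[X][X]) ^ x.2.card) =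
        ∑ S ∈ (R ∪ P)ᶜ.powerset, C (antiexcInvPoly R P) * X ^ (P.card + S.card) := by
      symm
      have hS : ∀ S ∈ (R ∪ P)ᶜ.powerset, Disjoint R S ∧ Disjoint P S := by
        intro S hS
        rw [← Finset.disjoint_union_left]
        exact Finset.disjoint_left.2 fun a ha ha' =>
          Finset.mem_compl.1 (Finset.mem_powerset.1 hS ha') ha
      refine Finset.sum_bij' (fun S _ => (R ∪ S, P ∪ S)) (fun x _ => x.1 ∩ x.2) ?_ ?_ ?_ ?_ ?_
      · intro S h
        obtain ⟨h1, h2⟩ := hS S h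
        rw [Finset.disjoint_left] at h1 h2 hdisj
        simp only [Finset.mem_filter, Finset.mem_univ, true_and, Prod.mk.injEq, Finset.ext_iff]
        grind
      · rintro ⟨E, V⟩ h
        simp only [Finset.mem_filter, Finset.mem_univ, true_and, Prod.mk.injEq] at h
        obtain ⟨rfl, rfl⟩ := h
        simp only [Finset.mem_powerset, Finset.subset_iff, Finset.mem_compl]
        grind
      · intro S h
        obtain ⟨h1, h2⟩ := hS S h
        rw [Finset.disjoint_left] at h1 h2 hdisj
        ext a
        grind
      · rintro ⟨E, V⟩ h
        simp only [Finset.mem_filter, Finset.mem_univ, true_and, Prod.mk.injEq] at h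
        obtain ⟨rfl, rfl⟩ := h
        refine Prod.ext ?_ ?_ <;> · ext a; grind
      · intro S h
        obtain ⟨h1, h2⟩ := hS S h
        rw [antiexcInvPoly_union S h1 h2, Finset.card_union_of_disjoint h2]
    rw [hsum]
    by_cases hcard : R.card = P.card
    · have hn : 2 * P.card + (R ∪ P)ᶜ.card = n := by
        have h1 := Finset.card_add_card_compl (R ∪ P)
        rw [Finset.card_union_of_disjoint hdisj, Fintype.card_fin] at h1
        omega
      convert gamma_mem_gammaCone (coeff_antiexcInvPoly_nonneg R P) hn using 1
      have hbinom : (1 + X : ℤ[X][X]) ^ (R ∪ P)ᶜ.card = ∑ S ∈ (R ∪ P)ᶜ.powerset, X ^ S.card := by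
        rw [← Finset.prod_const, Finset.prod_one_add]
        simp only [Finset.prod_const]
      rw [hbinom, Finset.mul_sum]
      simp only [pow_add, mul_assoc]
    · simp [antiexcInvPoly_eq_zero hcard]
  · rw [Finset.filter_eq_empty_iff.2, Finset.sum_empty]
    · exact zero_mem _
    · rintro ⟨E, V⟩ - h
      obtain ⟨rfl, rfl⟩ := Prod.ext_iff.1 h
      exact hdisj disjoint_sdiff_sdiff

theorem mainTheorem3 (n : ℕ) (hn : 0 < n) (stat : Equiv.Perm (Fin n) → ℕ)
    (hstat : stat = permCyc ∨ stat = permInv) :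
    (∃ b : ℕ → ℤ[X], (∀ i k : ℕ, 0 ≤ (b i).coeff k) ∧
      statExcPoly stat (evenDerangements n) =
        ∑ i ∈ Finset.range (n / 2 + 1),
          C (b i) * (X : ℤ[X][X]) ^ i * (1 + (X : ℤ[X][X])) ^ (n - 2 * i)) ∧
    (∃ b : ℕ → ℤ[X], (∀ i k : ℕ, 0 ≤ (b i).coeff k) ∧
      statExcPoly stat (oddDerangements n) =
        ∑ i ∈ Finset.range (n / 2 + 1),
          C (b i) * (X : ℤ[X][X]) ^ i * (1 + (X : ℤ[X][X])) ^ (n - 2 * i)) := by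
  rcases hstat with rfl | rfl
  · exact exists_gamma_of_sign_eq permCyc n sign_eq_neg_one_pow_permCyc
      (statExcPoly_permCyc_derangements_mem_gammaCone n)
  · exact exists_gamma_of_sign_eq permInv 0 sign_eq_neg_one_pow_permInv
      (statExcPoly_permInv_derangements_mem_gammaCone n)
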